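/- Let $a<b$ be real numbers, $\alpha\in(0,1)$ and $f\in C[a,b]$ (real-valued). For $t\in[a,b]$ let $$I_a^\alpha f(t)=\frac1{\Gamma(\alpha)}\int_a^t (t-\tau)^{\alpha-1}f(\tau)\,d\tau$$ be the Riemann–Liouville integral of order $\alpha$, and for $r\in\mathbb R$ and $s\ge 0$ put $$\phi(t,r)=\frac{\sin(\pi\alpha)}{\pi}\,e^{(1-\alpha)r}\int_a^t e^{-(t-\tau)e^r}f(\tau)\,d\tau,\qquad \hat\phi(t,s)=e^s\left(\frac1{1-\alpha}\,\phi\!\left(t,\frac{-s}{1-\alpha}\right)+\frac1\alpha\,\phi\!\left(t,\frac s\alpha\right)\right).$$ For $\Lambda\in\mathbb N$ let $Q_\Lambda^{GLa}[g]=\sum_{l=1}^{\Lambda}w_l\,g(x_l)$ be the $\Lambda$-point Gauss–Laguerre quadrature formula (weight $e^{-s}$ on $[0,\infty)$): its nodes $x_1,\dots,x_\Lambda$ are the zeros of the Laguerre polynomial $L_\Lambda$, and its weights are $w_l=\dfrac{x_l}{(\Lambda+1)^2\,L_{\Lambda+1}(x_l)^2}$, where $L_n(x)=\sum_{k=0}^n\binom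 nk\frac{(-1)^k}{k!}x^k$. Then, for every $t\in[a,b]$, $$\lim_{\Lambda\to\infty}Q_\Lambda^{GLa}[\hat\phi(t,\cdot)]=I_a^\alpha f(t).$$ -/

import Mathlib

open Filter Topology MeasureTheory Set Polynomial

noncomputable section

/-- The Laguerre polynomial `L_n(x) = ∑_{k=0}^n (n choose k) (-1)^k / k! x^k`, normalized by
`L_n(0) = 1`. -/
def laguerre (n : ℕ) : ℝ[X] :=
  ∑ k ∈ Finset.range (n + 1), C ((-1) ^ k * (n.choose k : ℝ) / (k.factorial : ℝ)) * X ^ k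

/-- The nodes of the `n`-point Gauss-Laguerre formula: the set of zeros of `L_n`. (All `n` zeros
of `L_n` are real, positive and simple.) -/
def gaussLaguerreNodes (n : ℕ) : Finset ℝ :=
  (laguerre n).roots.toFinset

/-- The weight of the `n`-point Gauss-Laguerre formula at a node `x`, namely
`x / ((n + 1)^2 L_{n+1}(x)^2)`. -/
def gaussLaguerreWeight (n : ℕ) (x : ℝ) : ℝ :=
  x / (((n : ℝ) + 1) ^ 2 * ((laguerre (n + 1)).eval x) ^ 2)

/-- The `n`-point Gauss-Laguerre quadrature formula for `∫_0^∞ e^{-s} g(s) ds`. -/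
def gaussLaguerreQuadrature (n : ℕ) (g : ℝ → ℝ) : ℝ :=
  ∑ x ∈ gaussLaguerreNodes n, gaussLaguerreWeight n x * g x

/-- The Riemann-Liouville integral `I_a^α f(t)` of order `α` with starting point `a`. -/
def riemannLiouville (a α : ℝ) (f : ℝ → ℝ) (t : ℝ) : ℝ :=
  1 / Real.Gamma α * ∫ τ in a..t, (t - τ) ^ (α - 1) * f τ

/-- The integrand `φ(t, r)` of the diffusive representation, with `c_α = π⁻¹ sin (π α)`. -/
def diffusivePhi (a α : ℝ) (f : ℝ → ℝ) (t r : ℝ) : ℝ :=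
  (Real.pi⁻¹ * Real.sin (Real.pi * α)) * Real.exp ((1 - α) * r) *
    ∫ τ in a..t, Real.exp (-(t - τ) * Real.exp r) * f τ

/-- The transformed integrand
`φ̂(t, s) = e^s (φ(t, -s/(1-α)) / (1-α) + φ(t, s/α) / α)`. -/
def diffusivePhiHat (a α : ℝ) (f : ℝ → ℝ) (t s : ℝ) : ℝ :=
  Real.exp s * (1 / (1 - α) * diffusivePhi a α f t (-s / (1 - α)) +
    1 / α * diffusivePhi a α f t (s / α))

end

/-! ### The functional `p ↦ ∫_0^∞ e^{-x} p(x) dx` -/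

/-! Two facts combine: Gauss-Laguerre quadrature converges for every bounded continuous function on
`[0, ∞)` (`gaussLaguerreConverges_of_continuousOn`), and `φ̂(t, ·)` is such a function, with
weighted integral `I_a^α f(t)`.

For convergence, orthogonality makes the rule exact in degree below `2n`, and its weights are
nonnegative. Hence convergence passes to limits whose error is dominated by a polynomial of small
integral (`of_approx`). Polynomials do not approximate uniformly on a half-line, so exponentials
intervene: Taylor expansion reaches `s^m e^{-ks/2}`, Weierstrass in `y = e^{-s/2}` reaches `g(s)
e^{-δs}` with `g` bounded and continuous, and `δ → 0` reaches `g`.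

For the integral, substituting `z = e^r` in Euler's integral writes `u^{α-1}` as a superposition of
the exponentials `e^{-u e^r}`; Fubini and the reflection formula then give `∫ φ(t, r) dr = I_a^α
f(t)`, and `φ̂` folds the two half-lines into one. -/

theorem integrableOn_exp_neg_mul_eval (p : ℝ[X]) :
    IntegrableOn (fun x => Real.exp (-x) * p.eval x) (Ioi 0) := by
  induction p using Polynomial.induction_on' with
  | add p q hp hq =>
    refine (hp.add hq).congr (ae_of_all _ fun x => ?_)
    simp [mul_add]
  | monomial n c =>
    have h := (Real.GammaIntegral_convergent (s := n + 1) (by positivity)).mul_const c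
    refine h.congr (ae_of_all _ fun x => ?_)
    simp only [add_sub_cancel_right, Real.rpow_natCast, eval_monomial]
    ring

/-- The Laguerre functional `p ↦ ∫_0^∞ e^{-x} p(x) dx`. -/
noncomputable def laguerreFunctional : ℝ[X] →ₗ[ℝ] ℝ where
  toFun p := ∫ x in Ioi (0 : ℝ), Real.exp (-x) * p.eval x
  map_add' p q := by
    rw [← integral_add (integrableOn_exp_neg_mul_eval p) (integrableOn_exp_neg_mul_eval q)]
    simp [mul_add]
  map_smul' c p := by
    rw [RingHom.id_apply, smul_eq_mul, ← integral_const_mul]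
    congr 1
    ext x
    simp only [eval_smul, smul_eq_mul]
    ring

theorem laguerreFunctional_apply (p : ℝ[X]) :
    laguerreFunctional p = ∫ x in Ioi (0 : ℝ), Real.exp (-x) * p.eval x := rfl

theorem laguerreFunctional_X_pow (n : ℕ) : laguerreFunctional (X ^ n) = n.factorial := by
  rw [laguerreFunctional_apply, ← Real.Gamma_nat_eq_factorial, Real.Gamma_eq_integral (by positivity)]
  simp

theorem laguerreFunctional_C_mul (c : ℝ) (p : ℝ[X]) :
    laguerreFunctional (C c * p) = c * laguerreFunctional p := by
  rw [← smul_eq_C_mul, map_smul, smul_eq_mul]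

theorem laguerreFunctional_one : laguerreFunctional 1 = 1 := by
  simpa using laguerreFunctional_X_pow 0

theorem laguerreFunctional_pos {p : ℝ[X]} (hp : p ≠ 0) (h : ∀ x, 0 < x → 0 ≤ p.eval x) :
    0 < laguerreFunctional p := by
  rw [laguerreFunctional_apply, setIntegral_pos_iff_support_of_nonneg_ae]
  · have hsub : Ioi (0 : ℝ) \ (p.roots.toFinset : Set ℝ) ⊆
        Function.support (fun x => Real.exp (-x) * p.eval x) ∩ Ioi 0 := by
      rintro x ⟨hx, hr⟩
      refine ⟨?_, hx⟩
      simp only [Finset.mem_coe, Multiset.mem_toFinset, mem_roots hp, IsRoot.def] at hr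
      simp [hr, Real.exp_ne_zero]
    refine lt_of_lt_of_le ?_ (measure_mono hsub)
    rw [measure_sdiff_null (p.roots.toFinset.finite_toSet.measure_zero _)]
    simp
  · filter_upwards [ae_restrict_mem measurableSet_Ioi] with x hx
    exact mul_nonneg (Real.exp_pos _).le (h x hx)
  · exact integrableOn_exp_neg_mul_eval p

/-! ### Orthogonality of the Laguerre polynomials -/

theorem coeff_laguerre (n k : ℕ) :
    (laguerre n).coeff k = (-1) ^ k * (n.choose k : ℝ) / (k.factorial : ℝ) := by
  simp only [laguerre, finsetSum_coeff, coeff_C_mul, coeff_X_pow, mul_ite, mul_one, mul_zero]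
  rw [Finset.sum_ite_eq]
  split_ifs with h
  · rfl
  · rw [Nat.choose_eq_zero_of_lt (by simpa using h)]
    simp

theorem natDegree_laguerre (n : ℕ) : (laguerre n).natDegree = n := by
  refine natDegree_eq_of_le_of_coeff_ne_zero ?_ ?_
  · rw [natDegree_le_iff_coeff_eq_zero]
    intro k hk
    rw [coeff_laguerre, Nat.choose_eq_zero_of_lt hk]
    simp
  · rw [coeff_laguerre]
    simp [Nat.factorial_ne_zero]

theorem leadingCoeff_laguerre (n : ℕ) :
    (laguerre n).leadingCoeff = (-1) ^ n / (n.factorial : ℝ) := by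
  rw [leadingCoeff, natDegree_laguerre, coeff_laguerre]
  simp

theorem laguerre_ne_zero (n : ℕ) : laguerre n ≠ 0 := by
  rw [← leadingCoeff_ne_zero, leadingCoeff_laguerre]
  simp [Nat.factorial_ne_zero]

/-- The moment `(k + m)!` divided by `k!` is `(k+1)⋯(k+m)`, a polynomial of degree `m` in `k`, so
the alternating binomial sum is an `n`-th finite difference. Orthogonality is then the vanishing of
high differences. -/
theorem laguerreFunctional_X_pow_mul_laguerre (m n : ℕ) :
    laguerreFunctional (X ^ m * laguerre n) =
      (-1) ^ n * (fwdDiff 1)^[n] ((ascPochhammer ℝ m).comp (X + 1)).eval 0 := by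
  rw [fwdDiff_iter_eq_sum_shift, laguerre, Finset.mul_sum, map_sum, Finset.mul_sum]
  refine Finset.sum_congr rfl fun k hk => ?_
  have hk : k ≤ n := by simpa [Nat.lt_succ_iff] using hk
  have h1 : (X ^ m * (C ((-1) ^ k * (n.choose k : ℝ) / (k.factorial : ℝ)) * X ^ k) : ℝ[X]) =
      C ((-1) ^ k * (n.choose k : ℝ) / (k.factorial : ℝ)) * X ^ (k + m) := by ring
  have h2 : (ascPochhammer ℝ m).eval ((k : ℝ) + 1) = ((k + 1).ascFactorial m : ℝ) := by
    rw [← ascPochhammer_nat_eq_ascFactorial, ascPochhammer_eval_cast]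
    push_cast
    rfl
  have h3 := Nat.factorial_mul_ascFactorial k m
  have hs : ((-1 : ℝ) ^ n) * (-1) ^ (n - k) = (-1) ^ k := by
    obtain ⟨j, rfl⟩ := Nat.exists_eq_add_of_le hk
    rw [Nat.add_sub_cancel_left, pow_add, mul_assoc, ← pow_add, Even.neg_one_pow ⟨j, rfl⟩, mul_one]
  rw [h1, laguerreFunctional_C_mul, laguerreFunctional_X_pow, ← h3]
  simp only [eval_comp, eval_add, eval_X, eval_one, zero_add, nsmul_eq_mul, mul_one, zsmul_eq_mul]
  rw [h2, ← hs]
  have := Nat.factorial_ne_zero k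
  push_cast
  field_simp

theorem natDegree_ascPochhammer_comp_X_add_one (m : ℕ) :
    ((ascPochhammer ℝ m).comp (X + 1)).natDegree = m := by
  rw [natDegree_comp, ascPochhammer_natDegree, ← C_1, natDegree_X_add_C, mul_one]

theorem laguerreFunctional_X_pow_mul_laguerre_of_lt {m n : ℕ} (h : m < n) :
    laguerreFunctional (X ^ m * laguerre n) = 0 := by
  rw [laguerreFunctional_X_pow_mul_laguerre, fwdDiff_iter_eq_zero_of_degree_lt]
  · simp
  · rwa [natDegree_ascPochhammer_comp_X_add_one]

theorem laguerreFunctional_X_pow_mul_laguerre_self (n : ℕ) :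
    laguerreFunctional (X ^ n * laguerre n) = (-1) ^ n * (n.factorial : ℝ) := by
  have h := fwdDiff_iter_degree_eq_factorial ((ascPochhammer ℝ n).comp (X + 1))
  have hm : ((ascPochhammer ℝ n).comp (X + 1)).Monic := by
    rw [← C_1]
    exact (monic_ascPochhammer ℝ n).comp_X_add_C 1
  rw [natDegree_ascPochhammer_comp_X_add_one, hm.leadingCoeff] at h
  rw [laguerreFunctional_X_pow_mul_laguerre, h]
  simp

theorem laguerreFunctional_mul_laguerre {n : ℕ} {p : ℝ[X]} (hp : p.natDegree ≤ n) :
    laguerreFunctional (p * laguerre n) = p.coeff n * ((-1) ^ n * (n.factorial : ℝ)) := by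
  rw [p.as_sum_range_C_mul_X_pow' (Nat.lt_succ_of_le hp), Finset.sum_mul, map_sum,
    Finset.sum_range_succ, Finset.sum_eq_zero]
  · rw [mul_assoc, laguerreFunctional_C_mul, laguerreFunctional_X_pow_mul_laguerre_self,
      ← p.as_sum_range_C_mul_X_pow' (Nat.lt_succ_of_le hp), zero_add]
  · intro i hi
    rw [mul_assoc, laguerreFunctional_C_mul,
      laguerreFunctional_X_pow_mul_laguerre_of_lt (by simpa using hi), mul_zero]

theorem laguerreFunctional_mul_laguerre_of_lt {n : ℕ} {p : ℝ[X]} (hp : p.natDegree < n) :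
    laguerreFunctional (p * laguerre n) = 0 := by
  rw [laguerreFunctional_mul_laguerre hp.le, coeff_eq_zero_of_natDegree_lt hp, zero_mul]

/-! ### Zeros of the Laguerre polynomials -/

/-- Here `q` would have degree below `n`, hence be orthogonal to `L_n`, while `q L_n = r q²` is
nonnegative and nonzero. Suitable `r` exclude nonpositive, multiple and nonreal roots. -/
theorem laguerre_ne_mul_of_nonneg {n : ℕ} {r q : ℝ[X]}
    (hr : ∀ x, 0 < x → 0 ≤ (r * q).eval x * q.eval x)
    (hdeg : 0 < r.natDegree) : laguerre n ≠ r * q := by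
  intro h
  have h0 : r * q ≠ 0 := h ▸ laguerre_ne_zero n
  have hr0 := left_ne_zero_of_mul h0
  have hq0 := right_ne_zero_of_mul h0
  have hn : r.natDegree + q.natDegree = n := by
    rw [← natDegree_mul hr0 hq0, ← h, natDegree_laguerre]
  have h1 : laguerreFunctional (q * laguerre n) = 0 :=
    laguerreFunctional_mul_laguerre_of_lt (by omega)
  have h2 : 0 < laguerreFunctional (q * laguerre n) := by
    refine laguerreFunctional_pos (mul_ne_zero hq0 (laguerre_ne_zero n)) fun x hx => ?_
    rw [h, eval_mul, mul_comm]
    exact hr x hx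
  exact h2.ne' h1

theorem pos_of_isRoot_laguerre {n : ℕ} {a : ℝ} (ha : (laguerre n).IsRoot a) : 0 < a := by
  by_contra! h
  obtain ⟨q, hq⟩ := dvd_iff_isRoot.mpr ha
  refine laguerre_ne_mul_of_nonneg (fun x hx => ?_) (by simp) hq
  simp only [eval_mul, eval_sub, eval_X, eval_C]
  nlinarith [mul_nonneg (by linarith : 0 ≤ x - a) (sq_nonneg (q.eval x))]

theorem nodup_roots_laguerre (n : ℕ) : (laguerre n).roots.Nodup := by
  rw [Multiset.nodup_iff_count_le_one]
  intro a
  by_contra! h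
  rw [count_roots] at h
  obtain ⟨q, hq⟩ := (le_rootMultiplicity_iff (laguerre_ne_zero n)).mp (show 2 ≤ _ from h)
  refine laguerre_ne_mul_of_nonneg (fun x hx => ?_) (by simp [natDegree_pow]) hq
  simp only [eval_mul, eval_pow, eval_sub, eval_X, eval_C]
  nlinarith [mul_nonneg (sq_nonneg (x - a)) (sq_nonneg (q.eval x))]

theorem splits_laguerre (n : ℕ) : (laguerre n).Splits := by
  obtain ⟨u, hu⟩ := UniqueFactorizationMonoid.factors_prod (laguerre_ne_zero n)
  rw [← hu]
  refine (Splits.multisetProd fun g hgm => Splits.of_degree_eq_one ?_).mul u.isUnit.splits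
  have hg := UniqueFactorizationMonoid.irreducible_of_factor g hgm
  have hgL := UniqueFactorizationMonoid.dvd_of_mem_factors hgm
  obtain ⟨z, hz⟩ : ∃ z : ℂ, aeval z g = 0 :=
    IsAlgClosed.exists_aeval_eq_zero _ g (degree_pos_of_irreducible hg).ne'
  by_cases him : z.im = 0
  · have hroot : g.IsRoot z.re := by
      have hzr : z = (algebraMap ℝ ℂ) z.re := by
        apply Complex.ext <;> simp [him]
      rw [hzr, aeval_algebraMap_apply] at hz
      simpa using hz
    exact degree_eq_one_of_irreducible_of_root hg hroot
  · exfalso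
    -- A nonreal root and its conjugate give the factor `(x - Re z)² + (Im z)²`, which is positive
    -- on the real line.
    obtain ⟨q, hq⟩ := (g.quadratic_dvd_of_aeval_eq_zero_im_ne_zero hz him).trans hgL
    refine laguerre_ne_mul_of_nonneg (fun x hx => ?_) ?_ hq
    · simp only [eval_mul, eval_add, eval_sub, eval_pow, eval_X, eval_C]
      have hn : ‖z‖ ^ 2 = z.re ^ 2 + z.im ^ 2 := by
        rw [← Complex.normSq_eq_norm_sq, Complex.normSq_apply]; ring
      rw [hn, mul_assoc]
      refine mul_nonneg ?_ (mul_self_nonneg _)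
      nlinarith [sq_nonneg (x - z.re), sq_nonneg z.im]
    · have : (X ^ 2 - C (2 * z.re) * X + C (‖z‖ ^ 2) : ℝ[X]).natDegree = 2 := by
        compute_degree!
      omega

theorem card_gaussLaguerreNodes (n : ℕ) : (gaussLaguerreNodes n).card = n := by
  rw [gaussLaguerreNodes, Multiset.toFinset_card_of_nodup (nodup_roots_laguerre n),
    ← (splits_laguerre n).natDegree_eq_card_roots, natDegree_laguerre]

theorem mem_gaussLaguerreNodes {n : ℕ} {x : ℝ} :
    x ∈ gaussLaguerreNodes n ↔ (laguerre n).eval x = 0 := by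
  simp [gaussLaguerreNodes, mem_roots (laguerre_ne_zero n)]

theorem pos_of_mem_gaussLaguerreNodes {n : ℕ} {x : ℝ} (hx : x ∈ gaussLaguerreNodes n) : 0 < x :=
  pos_of_isRoot_laguerre (mem_gaussLaguerreNodes.mp hx)

/-! ### Exactness of the Gauss-Laguerre formula -/

theorem X_mul_derivative_laguerre_succ (n : ℕ) :
    X * derivative (laguerre (n + 1)) =
      C ((n : ℝ) + 1) * (laguerre (n + 1) - laguerre n) := by
  ext k
  rcases k with _ | k
  · simp [coeff_laguerre]
  · rw [coeff_X_mul, coeff_derivative, coeff_C_mul, coeff_sub, coeff_laguerre, coeff_laguerre]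
    have h := Nat.add_one_mul_choose_eq n k
    have h' := congrArg (Nat.cast (R := ℝ)) h
    have h2 := congrArg (Nat.cast (R := ℝ)) (Nat.choose_succ_succ n k)
    push_cast [Nat.factorial_succ] at h' h2 ⊢
    have := Nat.factorial_ne_zero k
    field_simp
    rw [h2] at h' ⊢
    linear_combination (-1 : ℝ) * h'

theorem laguerre_succ_succ (n : ℕ) :
    C ((n : ℝ) + 2) * laguerre (n + 2) =
      (C (2 * (n : ℝ) + 3) - X) * laguerre (n + 1) - C ((n : ℝ) + 1) * laguerre n := by
  ext k
  rcases k with _ | k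
  · simp [sub_mul, coeff_laguerre, mul_comm X]
    ring
  · rw [sub_mul, coeff_sub, coeff_sub, coeff_X_mul, coeff_C_mul, coeff_C_mul, coeff_C_mul]
    simp only [coeff_laguerre]
    have h1 := congrArg (Nat.cast (R := ℝ)) (Nat.choose_succ_succ (n + 1) k)
    have h2 := congrArg (Nat.cast (R := ℝ)) (Nat.choose_succ_succ n k)
    have h3 := congrArg (Nat.cast (R := ℝ)) (Nat.add_one_mul_choose_eq (n + 1) k)
    have h4 := congrArg (Nat.cast (R := ℝ)) (Nat.add_one_mul_choose_eq n k)
    push_cast [Nat.factorial_succ] at h1 h2 h3 h4 ⊢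
    have key : ((n : ℝ) + 2) * ((n + 2).choose (k + 1) : ℝ) =
        (2 * n + 3) * ((n + 1).choose (k + 1) : ℝ) + (k + 1) * ((n + 1).choose k : ℝ) -
          (n + 1) * (n.choose (k + 1) : ℝ) := by
      rw [show n + 2 = n + 1 + 1 from rfl] at *
      linear_combination (n + 2 + (k + 1) : ℝ) * h1 + h3 - h4 - (n + 1 : ℝ) * h2
    have := Nat.factorial_ne_zero k
    field_simp
    linear_combination (-(-1 : ℝ) ^ k) * key

/-- Integrate `q L_n` in two ways: only the leading coefficient of `q` contributes, but replacing
`L_n` by the constant `L_n(x)` changes the product by a multiple of `L_{n+1}` with cofactor of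
degree below `n + 1`. -/
theorem laguerreFunctional_eq_of_laguerre_eq {n : ℕ} {x : ℝ} {q : ℝ[X]}
    (hq : laguerre (n + 1) = (X - C x) * q) :
    laguerreFunctional q * (laguerre n).eval x = -1 / ((n : ℝ) + 1) := by
  have hL := laguerre_ne_zero (n + 1)
  have hq0 : q ≠ 0 := right_ne_zero_of_mul (hq ▸ hL)
  have hdq : q.natDegree = n := by
    have := natDegree_laguerre (n + 1)
    rw [hq, natDegree_mul (X_sub_C_ne_zero x) hq0, natDegree_X_sub_C] at this
    omega
  have hlc : q.coeff n = (-1) ^ (n + 1) / ((n + 1).factorial : ℝ) := by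
    have := leadingCoeff_laguerre (n + 1)
    rwa [hq, leadingCoeff_mul, leadingCoeff_X_sub_C, one_mul, leadingCoeff, hdq] at this
  have h1 : laguerreFunctional (q * laguerre n) = -1 / ((n : ℝ) + 1) := by
    rw [laguerreFunctional_mul_laguerre hdq.le, hlc, Nat.factorial_succ]
    have := Nat.factorial_ne_zero n
    have h2 : ((-1 : ℝ) ^ n) * (-1) ^ n = 1 := by rw [← mul_pow]; simp
    push_cast
    field_simp
    linear_combination (-1 : ℝ) * h2
  obtain ⟨d, hd⟩ := X_sub_C_dvd_sub_C_eval (a := x) (p := laguerre n)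
  have hdd : d.natDegree < n + 1 := by
    by_cases hd0 : d = 0
    · simp [hd0]
    have h3 : ((X - C x) * d).natDegree ≤ n := by
      rw [← hd, natDegree_sub_C, natDegree_laguerre]
    rw [natDegree_mul (X_sub_C_ne_zero x) hd0, natDegree_X_sub_C] at h3
    omega
  have h4 : q * laguerre n = C ((laguerre n).eval x) * q + d * laguerre (n + 1) := by
    rw [hq]
    linear_combination q * hd
  rw [h4, map_add, laguerreFunctional_C_mul, laguerreFunctional_mul_laguerre_of_lt hdd] at h1
  linarith

theorem laguerreFunctional_lagrange_basis {n : ℕ} {x : ℝ} (hx : x ∈ gaussLaguerreNodes (n + 1)) :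
    laguerreFunctional (Lagrange.basis (gaussLaguerreNodes (n + 1)) id x) =
      gaussLaguerreWeight (n + 1) x := by
  have hroot := mem_gaussLaguerreNodes.mp hx
  obtain ⟨q, hq⟩ := dvd_iff_isRoot.mpr (IsRoot.def.mpr hroot)
  have hE := laguerreFunctional_eq_of_laguerre_eq hq
  have hL0 : (laguerre n).eval x ≠ 0 := by
    intro h
    rw [h, mul_zero, eq_comm, div_eq_zero_iff] at hE
    rcases hE with h | h
    · norm_num at h
    · exact absurd h (by positivity)
  have hq0 : q ≠ 0 := right_ne_zero_of_mul (hq ▸ laguerre_ne_zero (n + 1))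
  have hdq : q.natDegree = n := by
    have := natDegree_laguerre (n + 1)
    rw [hq, natDegree_mul (X_sub_C_ne_zero x) hq0, natDegree_X_sub_C] at this
    omega
  have hder : x * q.eval x = -((n : ℝ) + 1) * (laguerre n).eval x := by
    have h := congrArg (eval x) (X_mul_derivative_laguerre_succ n)
    rw [eval_mul, eval_mul, eval_sub, hroot, hq, derivative_mul] at h
    simp only [derivative_sub, derivative_X, derivative_C, eval_add, eval_mul, eval_sub, eval_X,
      eval_C, eval_one, eval_zero] at h
    linear_combination h
  have hrec : ((n : ℝ) + 2) * (laguerre (n + 2)).eval x = -((n : ℝ) + 1) * (laguerre n).eval x := by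
    have h := congrArg (eval x) (laguerre_succ_succ n)
    simp only [eval_mul, eval_sub, hroot, eval_C] at h
    linear_combination h
  have hx0 := pos_of_mem_gaussLaguerreNodes hx
  have hn : (0 : ℝ) < (n : ℝ) + 1 := by positivity
  have hqx : q.eval x ≠ 0 := by
    intro h
    rw [h, mul_zero, eq_comm, neg_mul, neg_eq_zero] at hder
    exact mul_ne_zero hn.ne' hL0 hder
  -- Both sides have degree `n` and agree at the `n + 1` nodes: `q` vanishes at every node except
  -- `x`.
  have hbasis : q = C (q.eval x) * Lagrange.basis (gaussLaguerreNodes (n + 1)) id x := by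
    refine eq_of_degrees_lt_of_eval_index_eq (v := id) (gaussLaguerreNodes (n + 1))
      (injOn_id _) ?_ ?_ ?_
    · rw [card_gaussLaguerreNodes, degree_eq_natDegree hq0, hdq]
      exact_mod_cast Nat.lt_succ_self n
    · rw [degree_C_mul hqx, Lagrange.degree_basis (injOn_id _) hx, card_gaussLaguerreNodes]
      exact_mod_cast Nat.lt_succ_self n
    · intro y hy
      rw [eval_mul, eval_C]
      by_cases hxy : x = y
      · subst hxy
        have := Lagrange.eval_basis_self (v := id) (injOn_id _) hx
        rw [id] at this ⊢
        rw [this, mul_one]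
      · rw [Lagrange.eval_basis_of_ne hxy hy, mul_zero]
        have h := mem_gaussLaguerreNodes.mp hy
        rw [hq, eval_mul] at h
        refine (mul_eq_zero.mp h).resolve_left ?_
        simpa [sub_eq_zero] using Ne.symm hxy
  rw [hbasis, laguerreFunctional_C_mul] at hE
  set B := laguerreFunctional (Lagrange.basis (gaussLaguerreNodes (n + 1)) id x)
  -- At a zero of `L_{n+1}` the three-term recurrence loses its middle term and trades `L_{n+2}` for
  -- `L_n`.
  have hw : (((n + 1 : ℕ) : ℝ) + 1) ^ 2 * (laguerre (n + 1 + 1)).eval x ^ 2 =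
      ((n : ℝ) + 1) ^ 2 * (laguerre n).eval x ^ 2 := by
    push_cast
    rw [← mul_pow, ← mul_pow, add_assoc (n : ℝ), one_add_one_eq_two, hrec]
    ring
  rw [gaussLaguerreWeight, hw, eq_div_iff (by positivity)]
  have hE' : q.eval x * B * (laguerre n).eval x * ((n : ℝ) + 1) = -1 := by
    rw [hE]
    field_simp
  refine mul_left_cancel₀ hqx ?_
  rw [mul_comm _ x, hder]
  linear_combination ((n : ℝ) + 1) * (laguerre n).eval x * hE'

/-- Divide by `L_n`: the quotient has degree below `n`, so its product with `L_n` integrates to zero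
and also vanishes at the nodes; the remainder equals its Lagrange interpolant. -/
theorem gaussLaguerreQuadrature_eval {n : ℕ} {p : ℝ[X]} (hp : p.natDegree < 2 * n) :
    gaussLaguerreQuadrature n (fun x => p.eval x) = laguerreFunctional p := by
  obtain ⟨n, rfl⟩ : ∃ m, n = m + 1 := ⟨n - 1, by omega⟩
  set L := laguerre (n + 1) with hL
  have hL0 : L ≠ 0 := laguerre_ne_zero _
  have hLd : L.natDegree = n + 1 := natDegree_laguerre _
  have hdiv : p = p / L * L + p % L := by
    rw [mul_comm, EuclideanDomain.div_add_mod]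
  have hdeg : (p / L).natDegree < n + 1 := by
    by_contra! h
    have hne : p / L ≠ 0 := by
      rintro h0
      simp [h0] at h
    have h1 : p.natDegree = (p / L).natDegree + L.natDegree := by
      have h2 := degree_add_div hL0 (not_lt.mp fun hlt => hne ((Polynomial.div_eq_zero_iff hL0).mpr hlt))
      have hp0 : p ≠ 0 := by
        rintro rfl
        simp at hne
      rw [degree_eq_natDegree hL0, degree_eq_natDegree hne, degree_eq_natDegree hp0] at h2
      have : L.natDegree + (p / L).natDegree = p.natDegree := by exact_mod_cast h2
      omega
    omega
  have hr : (p % L).degree < (gaussLaguerreNodes (n + 1)).card := by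
    rw [card_gaussLaguerreNodes, ← natDegree_laguerre (n + 1), ← degree_eq_natDegree hL0]
    exact EuclideanDomain.mod_lt p hL0
  have h1 : laguerreFunctional p = laguerreFunctional (p % L) := by
    conv_lhs => rw [hdiv]
    rw [map_add, laguerreFunctional_mul_laguerre_of_lt hdeg, zero_add]
  rw [h1, Lagrange.eq_interpolate (s := gaussLaguerreNodes (n + 1)) (v := id) (injOn_id _) hr,
    Lagrange.interpolate_apply, map_sum, gaussLaguerreQuadrature]
  refine Finset.sum_congr rfl fun x hx => ?_
  rw [laguerreFunctional_C_mul, laguerreFunctional_lagrange_basis hx, mul_comm]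
  congr 1
  conv_lhs => rw [hdiv]
  rw [eval_add, eval_mul, mem_gaussLaguerreNodes.mp hx, mul_zero, zero_add, id]

theorem gaussLaguerreWeight_nonneg {n : ℕ} {x : ℝ} (hx : x ∈ gaussLaguerreNodes n) :
    0 ≤ gaussLaguerreWeight n x := by
  have := pos_of_mem_gaussLaguerreNodes hx
  unfold gaussLaguerreWeight
  positivity

/-! ### Convergence of the Gauss-Laguerre formula -/

/-- The Gauss-Laguerre formulas converge to the integral `∫_0^∞ e^{-s} g(s) ds`, and this integral
exists. -/
def GaussLaguerreConverges (g : ℝ → ℝ) : Prop :=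
  IntegrableOn (fun s => Real.exp (-s) * g s) (Ioi 0) ∧
    Tendsto (fun n => gaussLaguerreQuadrature n g) atTop
      (𝓝 (∫ s in Ioi (0 : ℝ), Real.exp (-s) * g s))

theorem gaussLaguerreQuadrature_add (n : ℕ) (g h : ℝ → ℝ) :
    gaussLaguerreQuadrature n (fun s => g s + h s) =
      gaussLaguerreQuadrature n g + gaussLaguerreQuadrature n h := by
  simp only [gaussLaguerreQuadrature, mul_add, Finset.sum_add_distrib]

theorem gaussLaguerreQuadrature_const_mul (n : ℕ) (c : ℝ) (g : ℝ → ℝ) :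
    gaussLaguerreQuadrature n (fun s => c * g s) = c * gaussLaguerreQuadrature n g := by
  simp only [gaussLaguerreQuadrature, Finset.mul_sum]
  exact Finset.sum_congr rfl fun x _ => by ring

theorem abs_gaussLaguerreQuadrature_sub_le {n : ℕ} {g h r : ℝ → ℝ}
    (hr : ∀ s, 0 < s → |g s - h s| ≤ r s) :
    |gaussLaguerreQuadrature n g - gaussLaguerreQuadrature n h| ≤ gaussLaguerreQuadrature n r := by
  simp only [gaussLaguerreQuadrature, ← Finset.sum_sub_distrib, ← mul_sub]
  refine (Finset.abs_sum_le_sum_abs _ _).trans (Finset.sum_le_sum fun x hx => ?_)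
  rw [abs_mul, abs_of_nonneg (gaussLaguerreWeight_nonneg hx)]
  exact mul_le_mul_of_nonneg_left (hr x (pos_of_mem_gaussLaguerreNodes hx))
    (gaussLaguerreWeight_nonneg hx)

theorem eventually_gaussLaguerreQuadrature_eval (p : ℝ[X]) :
    ∀ᶠ n in atTop, gaussLaguerreQuadrature n (fun x => p.eval x) = laguerreFunctional p := by
  filter_upwards [eventually_gt_atTop p.natDegree] with n hn
  exact gaussLaguerreQuadrature_eval (by omega)

namespace GaussLaguerreConverges

theorem eval (p : ℝ[X]) : GaussLaguerreConverges fun s => p.eval s :=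
  ⟨integrableOn_exp_neg_mul_eval p, tendsto_const_nhds.congr' <|
    (eventually_gaussLaguerreQuadrature_eval p).mono fun _ h => h.symm⟩

theorem add {g h : ℝ → ℝ} (hg : GaussLaguerreConverges g) (hh : GaussLaguerreConverges h) :
    GaussLaguerreConverges fun s => g s + h s := by
  refine ⟨(hg.1.add hh.1).congr_fun (fun s _ => (mul_add _ _ _).symm) measurableSet_Ioi, ?_⟩
  simp only [mul_add, gaussLaguerreQuadrature_add]
  rw [integral_add hg.1 hh.1]
  exact hg.2.add hh.2

theorem const_mul {g : ℝ → ℝ} (hg : GaussLaguerreConverges g) (c : ℝ) :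
    GaussLaguerreConverges fun s => c * g s := by
  have hc : (fun s => Real.exp (-s) * (c * g s)) = fun s => c * (Real.exp (-s) * g s) := by
    ext s; ring
  refine ⟨by rw [hc]; exact hg.1.const_mul c, ?_⟩
  simp only [hc, gaussLaguerreQuadrature_const_mul]
  rw [integral_const_mul]
  exact hg.2.const_mul c

theorem finset_sum {ι : Type*} (t : Finset ι) {g : ι → ℝ → ℝ}
    (hg : ∀ i ∈ t, GaussLaguerreConverges (g i)) :
    GaussLaguerreConverges fun s => ∑ i ∈ t, g i s := by
  classical
  induction t using Finset.induction_on with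
  | empty => simpa using GaussLaguerreConverges.eval 0
  | insert i t hi ih =>
    simp only [Finset.sum_insert hi]
    exact (hg i (Finset.mem_insert_self i t)).add
      (ih fun j hj => hg j (Finset.mem_insert_of_mem hj))

/-- Functions which can be approximated by good ones up to an error dominated by a polynomial of
small integral are good. -/
theorem of_approx {g : ℝ → ℝ} (hg : IntegrableOn (fun s => Real.exp (-s) * g s) (Ioi 0))
    (happrox : ∀ ε > 0, ∃ h, GaussLaguerreConverges h ∧
      ∃ r : ℝ[X], (∀ s, 0 < s → |g s - h s| ≤ r.eval s) ∧ laguerreFunctional r ≤ ε) :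
    GaussLaguerreConverges g := by
  refine ⟨hg, Metric.tendsto_atTop'.mpr fun ε hε => ?_⟩
  -- Three errors arise, from the two integrals, the two quadratures, and the convergence for `h`;
  -- each costs at most `ε / 4`.
  obtain ⟨h, hh, r, hr, hrε⟩ := happrox (ε / 4) (by positivity)
  have hI : |(∫ s in Ioi (0 : ℝ), Real.exp (-s) * g s) - ∫ s in Ioi (0 : ℝ), Real.exp (-s) * h s|
      ≤ ε / 4 := by
    rw [← integral_sub hg hh.1]
    refine le_trans ?_ hrε
    rw [← Real.norm_eq_abs, laguerreFunctional_apply]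
    refine norm_integral_le_of_norm_le (integrableOn_exp_neg_mul_eval r) ?_
    filter_upwards [ae_restrict_mem measurableSet_Ioi] with s hs
    rw [← mul_sub, norm_mul, Real.norm_of_nonneg (Real.exp_pos _).le, Real.norm_eq_abs]
    exact mul_le_mul_of_nonneg_left (hr s hs) (Real.exp_pos _).le
  have h2 := Metric.tendsto_nhds.mp hh.2 (ε / 4) (by positivity)
  obtain ⟨N, hN⟩ := eventually_atTop.mp (h2.and (eventually_gaussLaguerreQuadrature_eval r))
  refine ⟨N, fun n hn => ?_⟩
  obtain ⟨hd, hq⟩ := hN n hn.le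
  have h3 := (abs_gaussLaguerreQuadrature_sub_le (n := n) hr).trans (hq.le.trans hrε)
  rw [Real.dist_eq, abs_lt] at *
  rw [abs_le] at *
  constructor <;> linarith [h3.1, h3.2, hI.1, hI.2, hd.1, hd.2]

end GaussLaguerreConverges

theorem integrableOn_exp_neg_mul_of_abs_le {g : ℝ → ℝ} (hg : ContinuousOn g (Ioi 0)) (r : ℝ[X])
    (hr : ∀ s, 0 < s → |g s| ≤ r.eval s) :
    IntegrableOn (fun s => Real.exp (-s) * g s) (Ioi 0) := by
  refine (integrableOn_exp_neg_mul_eval r).mono' ?_ ?_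
  · exact (ContinuousOn.mul (by fun_prop) hg).aestronglyMeasurable measurableSet_Ioi
  · filter_upwards [ae_restrict_mem measurableSet_Ioi] with s hs
    rw [norm_mul, Real.norm_of_nonneg (Real.exp_pos _).le, Real.norm_eq_abs]
    exact mul_le_mul_of_nonneg_left (hr s hs) (Real.exp_pos _).le

/-- The signed Taylor remainders of `e^{-x}` are nonnegative. -/
theorem exp_neg_taylor_remainder_nonneg (n : ℕ) {x : ℝ} (hx : 0 ≤ x) :
    0 ≤ (-1) ^ n * (Real.exp (-x) - ∑ j ∈ Finset.range n, (-x) ^ j / (j.factorial : ℝ)) := by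
  induction n generalizing x with
  | zero => simp [Real.exp_nonneg]
  | succ n ih =>
    set R : ℕ → ℝ → ℝ := fun n x =>
      (-1) ^ n * (Real.exp (-x) - ∑ j ∈ Finset.range n, (-x) ^ j / (j.factorial : ℝ)) with hR
    -- With this sign each remainder is an antiderivative of the previous one and vanishes at `0`,
    -- so nonnegativity propagates.
    have hder : ∀ y, HasDerivAt (R (n + 1)) (R n y) y := by
      intro y
      have h1 : HasDerivAt (fun y => ∑ j ∈ Finset.range (n + 1), (-y) ^ j / (j.factorial : ℝ))
          (∑ j ∈ Finset.range (n + 1), (j * (-y) ^ (j - 1) * (-1)) / (j.factorial : ℝ)) y := by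
        refine HasDerivAt.fun_sum fun j _ => ?_
        exact ((hasDerivAt_neg y).pow j).div_const _
      have h2 := (((hasDerivAt_neg y).exp).sub h1).const_mul ((-1 : ℝ) ^ (n + 1))
      refine h2.congr_deriv ?_
      rw [Finset.sum_range_succ']
      simp only [hR, Nat.add_sub_cancel, Nat.cast_zero, zero_mul, zero_div, add_zero]
      have h3 : ∀ j : ℕ, ((j + 1 : ℕ) : ℝ) * (-y) ^ j * (-1) / ((j + 1).factorial : ℝ) =
          -((-y) ^ j / (j.factorial : ℝ)) := by
        intro j
        have := Nat.factorial_ne_zero j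
        rw [Nat.factorial_succ]
        push_cast
        field_simp
      simp only [h3, Finset.sum_neg_distrib]
      ring
    have hmono : MonotoneOn (R (n + 1)) (Ici 0) := by
      refine monotoneOn_of_deriv_nonneg (convex_Ici 0)
        (fun y _ => (hder y).continuousAt.continuousWithinAt)
        (fun y _ => (hder y).differentiableAt.differentiableWithinAt) fun y hy => ?_
      rw [interior_Ici] at hy
      rw [(hder y).deriv]
      exact ih (le_of_lt hy)
    have h0 : R (n + 1) 0 = 0 := by
      simp [hR, Finset.sum_range_succ']
    rw [← h0]
    exact hmono (mem_Ici.mpr le_rfl) hx hx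

/-- Consecutive signed remainders are nonnegative and sum to `x^n / n!`. -/
theorem abs_exp_neg_sub_sum_le (n : ℕ) {x : ℝ} (hx : 0 ≤ x) :
    |Real.exp (-x) - ∑ j ∈ Finset.range n, (-x) ^ j / (j.factorial : ℝ)| ≤
      x ^ n / (n.factorial : ℝ) := by
  have h1 := exp_neg_taylor_remainder_nonneg n hx
  have h2 := exp_neg_taylor_remainder_nonneg (n + 1) hx
  rw [Finset.sum_range_succ, pow_succ] at h2
  set S := Real.exp (-x) - ∑ j ∈ Finset.range n, (-x) ^ j / (j.factorial : ℝ) with hS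
  have h3 : (-1 : ℝ) ^ n * (-x) ^ n = x ^ n := by rw [← mul_pow]; simp
  have h4 : |S| = (-1) ^ n * S := by
    rw [← abs_of_nonneg h1, abs_mul, abs_pow]; simp
  rw [h4]
  have h5 : (-1 : ℝ) ^ n * -1 *
      (Real.exp (-x) - (∑ j ∈ Finset.range n, (-x) ^ j / (j.factorial : ℝ) +
        (-x) ^ n / (n.factorial : ℝ))) = x ^ n / (n.factorial : ℝ) - (-1) ^ n * S := by
    rw [hS, ← h3]; ring
  linarith

theorem tendsto_factorial_add_div (m : ℕ) :
    Tendsto (fun n : ℕ => ((m + n).factorial : ℝ) * ((1 / 2) ^ n / (n.factorial : ℝ))) atTop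
      (𝓝 0) := by
  have h := (summable_choose_mul_geometric_of_norm_lt_one m
    (r := (1 / 2 : ℝ)) (by norm_num)).tendsto_atTop_zero.const_mul (m.factorial : ℝ)
  rw [mul_zero] at h
  refine h.congr fun n => ?_
  have h1 := congrArg (Nat.cast (R := ℝ)) (Nat.add_choose_mul_factorial_mul_factorial n m)
  push_cast at h1
  rw [add_comm m n, ← h1]
  have := Nat.factorial_ne_zero n
  field_simp

/-- Only one factor `e^{-s/2}` is expanded per induction step: the error bound then integrates to
`(m+n)! / (2^n n!) → 0`. Expanding `e^{-ks/2}` at once would replace `1/2` by `k/2`, and this bound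
would fail for `k ≥ 2`. -/
theorem gaussLaguerreConverges_pow_mul_exp (k m : ℕ) :
    GaussLaguerreConverges fun s => s ^ m * Real.exp (-(s / 2)) ^ k := by
  induction k generalizing m with
  | zero => simpa using GaussLaguerreConverges.eval (X ^ m)
  | succ k ih =>
    refine .of_approx ?_ fun ε hε => ?_
    · refine integrableOn_exp_neg_mul_of_abs_le (by fun_prop) (X ^ m) fun s hs => ?_
      rw [abs_mul, abs_of_nonneg (pow_nonneg hs.le m), eval_pow, eval_X]
      refine mul_le_of_le_one_right (pow_nonneg hs.le m) ?_
      rw [abs_of_nonneg (by positivity)]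
      exact pow_le_one₀ (Real.exp_nonneg _) (Real.exp_le_one_iff.mpr (by linarith))
    · obtain ⟨n, hn⟩ := ((tendsto_factorial_add_div m).eventually (gt_mem_nhds hε)).exists
      refine ⟨fun s => ∑ j ∈ Finset.range n,
        ((-1 / 2) ^ j / (j.factorial : ℝ)) * (s ^ (m + j) * Real.exp (-(s / 2)) ^ k),
        .finset_sum _ fun j _ => (ih (m + j)).const_mul _,
        C ((1 / 2) ^ n / (n.factorial : ℝ)) * X ^ (m + n), fun s hs => ?_, ?_⟩
      · have h1 : s ^ m * Real.exp (-(s / 2)) ^ (k + 1) - ∑ j ∈ Finset.range n,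
            ((-1 / 2) ^ j / (j.factorial : ℝ)) * (s ^ (m + j) * Real.exp (-(s / 2)) ^ k) =
            s ^ m * Real.exp (-(s / 2)) ^ k * (Real.exp (-(s / 2)) -
              ∑ j ∈ Finset.range n, (-(s / 2)) ^ j / (j.factorial : ℝ)) := by
          rw [mul_sub, Finset.mul_sum]
          congr 1
          · ring
          · refine Finset.sum_congr rfl fun j _ => ?_
            rw [show -(s / 2) = (-1 / 2) * s by ring, mul_pow, pow_add]
            ring
        have h2 := abs_exp_neg_sub_sum_le n (half_pos hs).le
        have h3 : Real.exp (-(s / 2)) ^ k ≤ 1 :=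
          pow_le_one₀ (Real.exp_nonneg _) (Real.exp_le_one_iff.mpr (by linarith))
        rw [h1, abs_mul, abs_of_nonneg (a := s ^ m * Real.exp (-(s / 2)) ^ k) (by positivity)]
        calc s ^ m * Real.exp (-(s / 2)) ^ k * _
            ≤ s ^ m * 1 * ((s / 2) ^ n / (n.factorial : ℝ)) := by gcongr
          _ = _ := by
            rw [eval_mul, eval_C, eval_pow, eval_X, div_pow, div_pow, one_pow, pow_add]
            ring
      · rw [laguerreFunctional_C_mul, laguerreFunctional_X_pow, mul_comm]
        exact hn.le

theorem gaussLaguerreConverges_eval_exp (p : ℝ[X]) :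
    GaussLaguerreConverges fun s => p.eval (Real.exp (-(s / 2))) := by
  simp only [eval_eq_sum_range]
  exact .finset_sum _ fun j _ => by
    simpa using (gaussLaguerreConverges_pow_mul_exp j 0).const_mul (p.coeff j)

theorem gaussLaguerreConverges_mul_exp {g : ℝ → ℝ} (hg : ContinuousOn g (Ici 0)) {M : ℝ}
    (hM : ∀ s, 0 ≤ s → |g s| ≤ M) {δ : ℝ} (hδ : 0 < δ) :
    GaussLaguerreConverges fun s => g s * Real.exp (-(δ * s)) := by
  have hM0 : 0 ≤ M := (abs_nonneg _).trans (hM 0 le_rfl)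
  have hb : ∀ s, 0 ≤ s → |g s * Real.exp (-(δ * s))| ≤ M * Real.exp (-(δ * s)) := fun s hs => by
    rw [abs_mul, abs_of_pos (Real.exp_pos _)]
    exact mul_le_mul_of_nonneg_right (hM s hs) (Real.exp_pos _).le
  refine .of_approx ?_ fun ε hε => ?_
  · refine integrableOn_exp_neg_mul_of_abs_le ((hg.mono Ioi_subset_Ici_self).mul (by fun_prop))
      (C M) fun s hs => (hb s hs.le).trans ?_
    rw [eval_C]
    exact mul_le_of_le_one_right hM0 (Real.exp_le_one_iff.mpr (by nlinarith))
  · -- in the variable `y = e^{-s/2}` the function extends continuously by `0` to `y = 0`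
    set h : ℝ → ℝ := fun y => g (-(2 * Real.log y)) * y ^ (2 * δ) with hh
    have hlog : ∀ y, y ∈ Icc (0 : ℝ) 1 → 0 ≤ -(2 * Real.log y) := fun y hy => by
      have := Real.log_nonpos hy.1 hy.2
      linarith
    have hcont : ContinuousOn h (Icc 0 1) := by
      intro y hy
      rcases hy.1.eq_or_lt with rfl | hy0
      -- The default `log 0 = 0` is harmless, since `0 ^ (2δ) = 0` fixes the value.
      · have h0 : h 0 = 0 := by simp [hh, Real.zero_rpow (by positivity : 2 * δ ≠ 0)]
        rw [ContinuousWithinAt, h0]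
        have ht : Tendsto (fun y : ℝ => M * y ^ (2 * δ)) (𝓝[Icc 0 1] 0) (𝓝 0) := by
          have : ContinuousAt (fun y : ℝ => M * y ^ (2 * δ)) 0 :=
            (Real.continuousAt_rpow_const 0 (2 * δ) (Or.inr (by positivity))).const_mul M
          have h1 := this.tendsto
          rw [Real.zero_rpow (by positivity : 2 * δ ≠ 0), mul_zero] at h1
          exact h1.mono_left nhdsWithin_le_nhds
        refine squeeze_zero_norm' ?_ ht
        filter_upwards [self_mem_nhdsWithin] with y hy
        rw [Real.norm_eq_abs, abs_mul, abs_of_nonneg (Real.rpow_nonneg hy.1 _)]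
        exact mul_le_mul_of_nonneg_right (hM _ (hlog y hy)) (Real.rpow_nonneg hy.1 _)
      · refine ContinuousWithinAt.mul ?_
          (Real.continuousAt_rpow_const y (2 * δ) (Or.inl hy0.ne')).continuousWithinAt
        refine ContinuousWithinAt.comp (t := Ici 0) (hg _ (hlog y hy)) ?_ hlog
        exact ((Real.continuousAt_log hy0.ne').const_mul 2).neg.continuousWithinAt
    obtain ⟨p, hp⟩ := exists_polynomial_near_of_continuousOn 0 1 h hcont ε hε
    refine ⟨_, gaussLaguerreConverges_eval_exp p, C ε, fun s hs => ?_, ?_⟩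
    · have hy : Real.exp (-(s / 2)) ∈ Icc (0 : ℝ) 1 :=
        ⟨Real.exp_nonneg _, Real.exp_le_one_iff.mpr (by linarith)⟩
      have h1 := hp _ hy
      have h2 : h (Real.exp (-(s / 2))) = g s * Real.exp (-(δ * s)) := by
        simp only [hh, Real.log_exp, ← Real.exp_mul]
        congr 2 <;> ring
      rw [h2, abs_sub_comm] at h1
      simpa using h1.le
    · rw [← mul_one (C ε), laguerreFunctional_C_mul, laguerreFunctional_one, mul_one]

/-- The Gauss-Laguerre formula converges for every bounded continuous function on `[0, ∞)`. -/
theorem gaussLaguerreConverges_of_continuousOn {g : ℝ → ℝ} (hg : ContinuousOn g (Ici 0)) {M : ℝ}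
    (hM : ∀ s, 0 ≤ s → |g s| ≤ M) : GaussLaguerreConverges g := by
  have hM0 : 0 ≤ M := (abs_nonneg _).trans (hM 0 le_rfl)
  refine .of_approx ?_ fun ε hε => ?_
  · exact integrableOn_exp_neg_mul_of_abs_le (hg.mono Ioi_subset_Ici_self) (C M) fun s hs => by
      simpa using hM s hs.le
  -- With `δ = ε / (M + 1)`, the error is at most `M δ s`, whose weighted integral is `M δ ≤ ε`; the
  -- `+ 1` covers `M = 0`.
  · have hδ : 0 < ε / (M + 1) := by positivity
    refine ⟨_, gaussLaguerreConverges_mul_exp hg hM hδ, C (M * (ε / (M + 1))) * X ^ 1,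
      fun s hs => ?_, ?_⟩
    · have h1 : g s - g s * Real.exp (-(ε / (M + 1) * s)) =
          g s * (1 - Real.exp (-(ε / (M + 1) * s))) := by ring
      have h2 := Real.add_one_le_exp (-(ε / (M + 1) * s))
      have h3 : Real.exp (-(ε / (M + 1) * s)) ≤ 1 := Real.exp_le_one_iff.mpr (by
        have := mul_pos hδ hs
        linarith)
      rw [h1, abs_mul, abs_of_nonneg (a := 1 - Real.exp _) (by linarith), eval_mul, eval_C, pow_one,
        eval_X, mul_assoc]
      exact mul_le_mul (hM s hs.le) (by linarith) (by linarith) hM0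
    · rw [laguerreFunctional_C_mul, laguerreFunctional_X_pow, Nat.factorial_one, Nat.cast_one,
        mul_one, ← mul_div_assoc, div_le_iff₀ (by positivity)]
      nlinarith

/-! ### The diffusive representation -/

theorem integral_exp_mul_exp_neg_mul_exp {α u : ℝ} (hα : α < 1) (hu : 0 < u) :
    ∫ r : ℝ, Real.exp ((1 - α) * r) * Real.exp (-u * Real.exp r) =
      Real.Gamma (1 - α) * u ^ (α - 1) := by
  have h := integral_image_eq_integral_abs_deriv_smul (s := univ) MeasurableSet.univ
    (fun x _ => (Real.hasDerivAt_exp x).hasDerivWithinAt) Real.exp_injective.injOn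
    (fun z => z ^ ((1 - α) - 1) * Real.exp (-(u * z)))
  rw [image_univ, Real.range_exp, Real.integral_rpow_mul_exp_neg_mul_Ioi (by linarith) hu,
    setIntegral_univ] at h
  rw [one_div, Real.inv_rpow hu.le, ← Real.rpow_neg hu.le, neg_sub, mul_comm] at h
  rw [h]
  congr 1
  ext r
  rw [abs_of_pos (Real.exp_pos r), smul_eq_mul, ← Real.exp_mul]
  simp only [← Real.exp_add]
  congr 1
  ring

theorem integrable_exp_mul_exp_neg_mul_exp {α u : ℝ} (hα : α < 1) (hu : 0 < u) :
    Integrable fun r : ℝ => Real.exp ((1 - α) * r) * Real.exp (-u * Real.exp r) := by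
  -- A nonintegrable function has integral `0` by convention, so the nonzero value already computed
  -- proves integrability.
  refine .of_integral_ne_zero ?_
  rw [integral_exp_mul_exp_neg_mul_exp hα hu]
  have := Real.Gamma_pos_of_pos (sub_pos.mpr hα)
  positivity

/-- This justifies Fubini: integrating absolute values over `r` leaves `Γ(1-α) (t-τ)^{α-1} |f τ|`,
integrable because `α - 1 > -1`. The divergent slice `τ = t` is null. -/
theorem integrable_diffusive_kernel {a t α : ℝ} (hat : a ≤ t) (hα : α ∈ Ioo (0 : ℝ) 1) {f : ℝ → ℝ}
    (hf : Continuous f) :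
    Integrable (fun p : ℝ × ℝ => Real.exp ((1 - α) * p.2) * Real.exp (-(t - p.1) * Real.exp p.2) *
      f p.1) ((volume.restrict (Ioc a t)).prod volume) := by
  have hcont : Continuous (fun p : ℝ × ℝ =>
      Real.exp ((1 - α) * p.2) * Real.exp (-(t - p.1) * Real.exp p.2) * f p.1) := by fun_prop
  have hlt : ∀ᵐ τ ∂(volume.restrict (Ioc a t)), τ < t := by
    have h1 : ∀ᵐ τ ∂(volume.restrict (Ioc a t)), τ ≠ t :=
      ae_restrict_of_ae (Measure.ae_ne volume t)
    filter_upwards [ae_restrict_mem measurableSet_Ioc, h1] with τ hτ hne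
    exact lt_of_le_of_ne hτ.2 hne
  rw [integrable_prod_iff hcont.aestronglyMeasurable]
  constructor
  · filter_upwards [hlt] with τ hτ
    exact (integrable_exp_mul_exp_neg_mul_exp hα.2 (sub_pos.mpr hτ)).mul_const _
  · have h2 : IntervalIntegrable (fun τ => (t - τ) ^ (α - 1) * |f τ|) volume a t := by
      have h3 := (intervalIntegral.intervalIntegrable_rpow' (a := t - a) (b := t - t) (r := α - 1)
        (by linarith [hα.1])).comp_sub_left t
      simp only [sub_sub_cancel] at h3
      exact h3.mul_continuousOn hf.abs.continuousOn
    rw [intervalIntegrable_iff_integrableOn_Ioc_of_le hat] at h2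
    refine (h2.const_mul (Real.Gamma (1 - α))).congr ?_
    filter_upwards [hlt] with τ hτ
    simp only [norm_mul, Real.norm_eq_abs, Real.abs_exp]
    rw [integral_mul_const, integral_exp_mul_exp_neg_mul_exp hα.2 (sub_pos.mpr hτ)]
    ring

theorem diffusivePhi_eq {a t α : ℝ} (hat : a ≤ t) (f : ℝ → ℝ) (r : ℝ) :
    diffusivePhi a α f t r = Real.pi⁻¹ * Real.sin (Real.pi * α) * ∫ τ in Ioc a t,
      Real.exp ((1 - α) * r) * Real.exp (-(t - τ) * Real.exp r) * f τ := by
  rw [diffusivePhi, intervalIntegral.integral_of_le hat, mul_assoc, ← integral_const_mul]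
  simp only [mul_assoc]

theorem integrable_diffusivePhi {a t α : ℝ} (hat : a ≤ t) (hα : α ∈ Ioo (0 : ℝ) 1) {f : ℝ → ℝ}
    (hf : Continuous f) : Integrable (diffusivePhi a α f t) := by
  rw [funext (diffusivePhi_eq (α := α) hat f)]
  exact (integrable_diffusive_kernel hat hα hf).integral_prod_right.const_mul _

/-- The Riemann-Liouville integral is the integral of the diffusive representation. -/
theorem integral_diffusivePhi {a t α : ℝ} (hat : a ≤ t) (hα : α ∈ Ioo (0 : ℝ) 1) {f : ℝ → ℝ}
    (hf : Continuous f) : ∫ r, diffusivePhi a α f t r = riemannLiouville a α f t := by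
  have h1 : ∫ τ in Ioc a t, ∫ r : ℝ,
      Real.exp ((1 - α) * r) * Real.exp (-(t - τ) * Real.exp r) * f τ =
      ∫ τ in Ioc a t, Real.Gamma (1 - α) * ((t - τ) ^ (α - 1) * f τ) := by
    refine integral_congr_ae ?_
    filter_upwards [ae_restrict_mem measurableSet_Ioc,
      ae_restrict_of_ae (Measure.ae_ne volume t)] with τ hτ hne
    rw [integral_mul_const,
      integral_exp_mul_exp_neg_mul_exp hα.2 (sub_pos.mpr (lt_of_le_of_ne hτ.2 hne)), mul_assoc]
  simp only [diffusivePhi_eq hat]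
  rw [integral_const_mul, ← integral_integral_swap (integrable_diffusive_kernel hat hα hf), h1,
    integral_const_mul, riemannLiouville, intervalIntegral.integral_of_le hat, ← mul_assoc]
  congr 1
  -- The reflection formula turns `sin(πα) Γ(1-α) / π` into `1 / Γ(α)`.
  have hG := Real.Gamma_mul_Gamma_one_sub α
  have hΓ := (Real.Gamma_pos_of_pos hα.1).ne'
  have hs : Real.sin (Real.pi * α) ≠ 0 := by
    refine (Real.sin_pos_of_pos_of_lt_pi (by have := hα.1; positivity) ?_).ne'
    nlinarith [Real.pi_pos, hα.2]
  rw [eq_div_iff hs] at hG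
  have hπ := Real.pi_ne_zero
  rw [eq_div_iff hΓ]
  calc _ = Real.pi⁻¹ * (Real.Gamma α * Real.Gamma (1 - α) * Real.sin (Real.pi * α)) := by ring
    _ = 1 := by rw [hG, inv_mul_cancel₀ hπ]

theorem continuous_diffusivePhi (a t α : ℝ) {f : ℝ → ℝ} (hf : Continuous f) :
    Continuous (diffusivePhi a α f t) := by
  unfold diffusivePhi
  refine Continuous.mul (by fun_prop) ?_
  refine intervalIntegral.continuous_parametric_intervalIntegral_of_continuous' ?_ a t
  simp only [Function.uncurry_def]
  fun_prop

theorem continuous_diffusivePhiHat (a t α : ℝ) {f : ℝ → ℝ} (hf : Continuous f) :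
    Continuous (diffusivePhiHat a α f t) := by
  have h := continuous_diffusivePhi a t α hf
  unfold diffusivePhiHat
  fun_prop

/-- The weight cancels `e^s`; `r = -s/(1-α)` and `r = s/α` then map the two terms to the negative
and positive half-lines, the prefactors being the Jacobians. -/
theorem integral_exp_neg_mul_diffusivePhiHat {a t α : ℝ} (hat : a ≤ t) (hα : α ∈ Ioo (0 : ℝ) 1)
    {f : ℝ → ℝ} (hf : Continuous f) :
    ∫ s in Ioi (0 : ℝ), Real.exp (-s) * diffusivePhiHat a α f t s =
      riemannLiouville a α f t := by
  set φ := diffusivePhi a α f t with hφ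
  have hint : Integrable φ := integrable_diffusivePhi hat hα hf
  have h1α : 0 < 1 / (1 - α) := by
    have := sub_pos.mpr hα.2
    positivity
  have hα' : 0 < 1 / α := by
    have := hα.1
    positivity
  have hexp : ∀ s, Real.exp (-s) * diffusivePhiHat a α f t s =
      1 / (1 - α) * φ (-(1 / (1 - α) * s)) + 1 / α * φ (1 / α * s) := fun s => by
    rw [diffusivePhiHat, ← mul_assoc, ← Real.exp_add, neg_add_cancel, Real.exp_zero, one_mul]
    rw [show -s / (1 - α) = -(1 / (1 - α) * s) by ring, show s / α = 1 / α * s by ring]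
  have hi1 : IntegrableOn (fun s => 1 / (1 - α) * φ (-(1 / (1 - α) * s))) (Ioi 0) :=
    ((integrableOn_Ioi_comp_mul_left_iff (fun r => φ (-r)) 0 h1α).mpr
      hint.comp_neg.integrableOn).const_mul _
  have hi2 : IntegrableOn (fun s => 1 / α * φ (1 / α * s)) (Ioi 0) :=
    ((integrableOn_Ioi_comp_mul_left_iff φ 0 hα').mpr hint.integrableOn).const_mul _
  have e1 := integral_comp_mul_left_Ioi' (fun r => φ (-r)) 0 h1α
  have e2 := integral_comp_mul_left_Ioi' φ 0 hα'
  simp only [smul_eq_mul, mul_zero] at e1 e2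
  simp only [hexp]
  rw [integral_add hi1 hi2, integral_const_mul, integral_const_mul, e1, e2, integral_comp_neg_Ioi,
    neg_zero, intervalIntegral.integral_Iic_add_Ioi hint.integrableOn hint.integrableOn,
    integral_diffusivePhi hat hα hf]

/-! ### Boundedness of the transformed integrand -/

theorem abs_integral_exp_mul_le {a t z M : ℝ} (hat : a ≤ t) (hz : 0 < z) {f : ℝ → ℝ}
    (hM : ∀ τ ∈ Icc a t, |f τ| ≤ M) :
    |∫ τ in a..t, Real.exp (-(t - τ) * z) * f τ| ≤ M * (t - a) := by
  rw [← Real.norm_eq_abs, ← abs_of_nonneg (sub_nonneg.mpr hat)]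
  refine intervalIntegral.norm_integral_le_of_norm_le_const fun τ hτ => ?_
  rw [uIoc_of_le hat] at hτ
  rw [norm_mul, Real.norm_of_nonneg (Real.exp_pos _).le, Real.norm_eq_abs]
  have h1 : Real.exp (-(t - τ) * z) ≤ 1 := Real.exp_le_one_iff.mpr (by nlinarith [hτ.2])
  exact (mul_le_of_le_one_left (abs_nonneg _) h1).trans (hM τ (Ioc_subset_Icc_self hτ))

theorem abs_integral_exp_mul_le_div {a t z M : ℝ} (hat : a ≤ t) (hz : 0 < z) {f : ℝ → ℝ}
    (hM : ∀ τ ∈ Icc a t, |f τ| ≤ M) :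
    |∫ τ in a..t, Real.exp (-(t - τ) * z) * f τ| ≤ M / z := by
  have hM0 : 0 ≤ M := (abs_nonneg _).trans (hM a (left_mem_Icc.mpr hat))
  have hder : ∀ τ ∈ uIcc a t, HasDerivAt (fun τ => M / z * Real.exp (-(t - τ) * z))
      (M * Real.exp (-(t - τ) * z)) τ := fun τ _ => by
    have h := (((((hasDerivAt_id τ).const_sub t).neg).mul_const z).exp).const_mul (M / z)
    refine h.congr_deriv ?_
    simp only [Pi.neg_apply, id]
    field_simp
  have hci : IntervalIntegrable (fun τ => M * Real.exp (-(t - τ) * z)) volume a t :=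
    Continuous.intervalIntegrable (by fun_prop) a t
  have h1 : ‖∫ τ in a..t, Real.exp (-(t - τ) * z) * f τ‖ ≤
      ∫ τ in a..t, M * Real.exp (-(t - τ) * z) := by
    refine intervalIntegral.norm_integral_le_of_norm_le hat (ae_of_all _ fun τ hτ => ?_) hci
    rw [norm_mul, Real.norm_of_nonneg (Real.exp_pos _).le, Real.norm_eq_abs, mul_comm]
    exact mul_le_mul_of_nonneg_right (hM τ (Ioc_subset_Icc_self hτ)) (Real.exp_pos _).le
  rw [intervalIntegral.integral_eq_sub_of_hasDerivAt hder hci, sub_self, neg_zero, zero_mul,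
    Real.exp_zero, mul_one] at h1
  exact h1.trans (sub_le_self _ (by positivity))

/-- In the first term `e^s` cancels `e^{(1-α)r}` exactly, so the trivial bound on the inner integral
suffices. In the second the product is `e^{s/α} = e^r`, absorbed by the bound `M / z` at `z = e^r`.
-/
theorem abs_diffusivePhiHat_le {a t α M : ℝ} (hat : a ≤ t) (hα : α ∈ Ioo (0 : ℝ) 1) {f : ℝ → ℝ}
    (hM : ∀ τ ∈ Icc a t, |f τ| ≤ M) (s : ℝ) :
    |diffusivePhiHat a α f t s| ≤
      |Real.pi⁻¹ * Real.sin (Real.pi * α)| * (1 / (1 - α) * (M * (t - a)) + 1 / α * M) := by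
  have h1α := sub_pos.mpr hα.2
  have hα0 := hα.1
  set c := Real.pi⁻¹ * Real.sin (Real.pi * α)
  set I : ℝ → ℝ := fun r => ∫ τ in a..t, Real.exp (-(t - τ) * Real.exp r) * f τ with hI
  have e1 : Real.exp s * Real.exp ((1 - α) * (-s / (1 - α))) = 1 := by
    rw [← Real.exp_add, mul_div_cancel₀ _ h1α.ne', add_neg_cancel, Real.exp_zero]
  have e2 : Real.exp s * Real.exp ((1 - α) * (s / α)) = Real.exp (s / α) := by
    rw [← Real.exp_add]
    congr 1
    field_simp
    ring
  have hsum : diffusivePhiHat a α f t s =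
      c * (1 / (1 - α) * I (-s / (1 - α)) + 1 / α * (Real.exp (s / α) * I (s / α))) := by
    rw [diffusivePhiHat, diffusivePhi, diffusivePhi]
    linear_combination (c * (1 / (1 - α)) * I (-s / (1 - α))) * e1 +
      (c * (1 / α) * I (s / α)) * e2
  have b1 : |I (-s / (1 - α))| ≤ M * (t - a) := abs_integral_exp_mul_le hat (Real.exp_pos _) hM
  have b2 : |Real.exp (s / α) * I (s / α)| ≤ M := by
    have h := abs_integral_exp_mul_le_div hat (Real.exp_pos (s / α)) hM
    rw [le_div_iff₀ (Real.exp_pos _)] at h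
    rwa [abs_mul, Real.abs_exp, mul_comm]
  rw [hsum, abs_mul]
  refine mul_le_mul_of_nonneg_left ((abs_add_le _ _).trans ?_) (abs_nonneg _)
  rw [abs_mul, abs_mul _ (Real.exp _ * _), abs_of_pos (one_div_pos.mpr h1α),
    abs_of_pos (one_div_pos.mpr hα0)]
  gcongr

theorem theorem5 (a b : ℝ) (hab : a < b) (α : ℝ) (hα : α ∈ Set.Ioo (0 : ℝ) 1)
    (f : ℝ → ℝ) (hf : ContinuousOn f (Set.Icc a b)) :
    ∀ t ∈ Set.Icc a b,
      Tendsto (fun Λ : ℕ => gaussLaguerreQuadrature Λ (fun s => diffusivePhiHat a α f t s))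
        atTop (𝓝 (riemannLiouville a α f t)) := by
  intro t ht
  -- Both sides see only the values of `f` on `[a, t]`, so `f` may be replaced by a continuous
  -- extension to `ℝ`.
  set F : ℝ → ℝ := IccExtend hab.le ((Icc a b).domRestrict f) with hF
  have hFc : Continuous F := hf.domRestrict.Icc_extend'
  have hFf : ∀ τ ∈ uIcc a t, f τ = F τ := fun τ hτ => by
    rw [uIcc_of_le ht.1] at hτ
    rw [hF, IccExtend_of_mem hab.le _ (show τ ∈ Icc a b from ⟨hτ.1, hτ.2.trans ht.2⟩),
      domRestrict_apply]
  have hφ : ∀ r, diffusivePhi a α f t r = diffusivePhi a α F t r := fun r => by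
    unfold diffusivePhi
    congr 1
    exact intervalIntegral.integral_congr fun τ hτ => by simp only [hFf τ hτ]
  have hφhat : diffusivePhiHat a α f t = diffusivePhiHat a α F t := by
    ext s
    simp only [diffusivePhiHat, hφ]
  have hRL : riemannLiouville a α f t = riemannLiouville a α F t := by
    unfold riemannLiouville
    congr 1
    exact intervalIntegral.integral_congr fun τ hτ => by simp only [hFf τ hτ]
  obtain ⟨M, hM⟩ := isCompact_Icc.exists_bound_of_continuousOn (hFc.continuousOn (s := Icc a t))
  have h := gaussLaguerreConverges_of_continuousOn
    (continuous_diffusivePhiHat a t α hFc).continuousOn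
    (fun s _ => abs_diffusivePhiHat_le ht.1 hα hM s)
  rw [hRL, ← integral_exp_neg_mul_diffusivePhiHat ht.1 hα hFc, hφhat]
  exact h.2
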